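/- Graphs are finite and may have loops and parallel edges. A signed graph $(G,\sigma)$ is a graph $G$ with a signature $\sigma:E(G)\to\{+,-\}$. For $X\subseteq V(G)$, switching at the edge cut $\partial_G(X)$ changes the signs of exactly the edges of $\partial_G(X)$. The frustration index $l(G,\sigma)$ is the least number of negative edges of a signature obtained from $\sigma$ by switching, and $(G,\sigma)$ is critically $k$-frustrated if $l(G,\sigma)=k$ and $l(G\setminus e,\sigma)=k-1$ for every edge $e$. To subdivide a nonempty set of $t$ parallel edges of the same sign $s$ between $x$ and $y$ ($x=y$ allowed) means to delete them and to add a new vertex $w$, $t$ positive edges between $x$ and $w$, and $t$ edges of sign $s$ between $w$ and $y$. A signed graph is irreducible if it is not obtained from a signed graph by one or more such operations. A cycle is negative if it has an odd number of negative edges. Let $\mathcal S^*(k)$ be the class of critically $k$-frustrated signed graphs that are irreducible and contain no two edge-disjoint negative cycles. A canonical embedding of $(G,\sigma)\in\mathcal S^*(k)$ is a presentation of it as follows (it amounts to an embedding in the projective plane with the $k$ negative edges in a cross cap): take a $2$-connected plane cubic graph $G'$ (loopless, parallel edges allowed) with all edges positive, choose a facial circuit $C'$ of it, insert $2k$ distinct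 vertices $z_1,\dots,z_{2k}$, in this cyclic order, on the edges of $C'$, keeping all edges positive, and add the $k$ negative edges $z_iz_{k+i}$, $1\le i\le k$. The face of $G'$ bounded by $C'$ that receives the cross cap is called the outer face. For another face $F$ of $G'$, with boundary cycle $C_F$, call $F$ a boundary face if $C_F$ shares an edge with $C'$, and an internal face otherwise. A boundary face $F$ is a bridge face if the subgraph $C_F\cap C'$ is disconnected. A canonical embedding is normal if it has no bridge face. Two distinct faces of $G'$ are adjacent if their boundaries share an edge. **Lemma.** Let $k\in\{4,5\}$ and $(G,\sigma)\in\mathcal S^*(k)$, and fix a normal canonical embedding of $(G,\sigma)$. Then every internal face of $G'$ is adjacent to at least two distinct boundary faces. -/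

import Mathlib

noncomputable section

/-! ## Signed multigraphs

Multigraphs (loops and parallel edges allowed) are Mathlib's `Graph α β`.  A signature is a map
`σ : β → ℤˣ`, of which only the values on the edges of the graph matter; an edge `e` is negative
when `σ e = -1`. -/

namespace Graph

variable {α β : Type*}

/-- The edge cut `∂_G(X)`: the edges with one end in `X` and the other end outside `X`. -/
def cut (G : Graph α β) (X : Set α) : Set β :=
  {e | ∃ x y, G.IsLink e x y ∧ x ∈ X ∧ y ∉ X}

/-- The set of negative edges of `(G, σ)`. -/
def negEdges (G : Graph α β) (σ : β → ℤˣ) : Set β :=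
  {e | e ∈ E(G) ∧ σ e = -1}

/-- `π` is obtained from `σ` by switching at some edge cut `∂_G(X)`, that is, by changing the
signs of exactly the edges of the cut. -/
def SwitchingEquiv (G : Graph α β) (σ π : β → ℤˣ) : Prop :=
  ∃ X : Set α, ∀ e ∈ E(G), (e ∈ G.cut X → π e = -σ e) ∧ (e ∉ G.cut X → π e = σ e)

/-- The frustration index: the least number of negative edges of a switching equivalent
signature. -/
def frustrationIndex (G : Graph α β) (σ : β → ℤˣ) : ℕ :=
  sInf {n : ℕ | ∃ π : β → ℤˣ, G.SwitchingEquiv σ π ∧ (G.negEdges π).ncard = n}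

/-- `(G, σ)` is critically `k`-frustrated: its frustration index is `k` and the deletion of any
edge makes it `k - 1`. -/
def IsCriticallyFrustrated (k : ℕ) (G : Graph α β) (σ : β → ℤˣ) : Prop :=
  G.frustrationIndex σ = k ∧ ∀ e ∈ E(G), (G.deleteEdges {e}).frustrationIndex σ + 1 = k

/-- The degree of a vertex; a loop counts twice. -/
def deg (G : Graph α β) (x : α) : ℕ∞ :=
  (G.incidenceSet x).encard + (G.loopSet x).encard

/-- A graph is connected if it has a vertex and any two of its vertices are joined by a walk. -/
def IsConnected (G : Graph α β) : Prop :=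
  V(G).Nonempty ∧ ∀ x ∈ V(G), ∀ y ∈ V(G), Relation.ReflTransGen G.Adj x y

/-- 2-connected multigraphs: connected, without loops and without cut vertices (and, since the
empty graph is not connected, with at least two vertices). -/
def IsTwoConnected (G : Graph α β) : Prop :=
  G.IsConnected ∧ G.Loopless ∧ ∀ x ∈ V(G), (G.deleteVerts {x}).IsConnected

/-- A cycle is a (finite) connected 2-regular graph. -/
def IsCycleGraph (C : Graph α β) : Prop :=
  V(C).Finite ∧ C.IsConnected ∧ ∀ x ∈ V(C), C.deg x = 2

/-- `C` is a negative cycle of `(G, σ)`: a cycle in `G` with an odd number of negative edges. -/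
def IsNegativeCycle (G : Graph α β) (σ : β → ℤˣ) (C : Graph α β) : Prop :=
  C ≤ G ∧ C.IsCycleGraph ∧ Odd (C.negEdges σ).ncard

/-- One subdivision step, from the signed graph `P = (H, π)` to the signed graph `Q = (G, σ)`:
a nonempty set `S` of parallel edges of `H` between `x` and `y`, all of the same sign `s`, is
deleted, and a new vertex `w` is added together with a set `A` of `|S|` positive edges between `x`
and `w` and a set `B` of `|S|` edges of sign `s` between `w` and `y`. -/
def SubdivStep (P Q : Graph α β × (β → ℤˣ)) : Prop :=
  ∃ (x y w : α) (s : ℤˣ) (S A B : Set β),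
    x ∈ V(P.1) ∧ y ∈ V(P.1) ∧ w ∉ V(P.1) ∧
    S.Nonempty ∧ (∀ e ∈ S, P.1.IsLink e x y ∧ P.2 e = s) ∧
    A.encard = S.encard ∧ B.encard = S.encard ∧
    Disjoint A B ∧ Disjoint A (E(P.1) \ S) ∧ Disjoint B (E(P.1) \ S) ∧
    V(Q.1) = insert w V(P.1) ∧
    (∀ e u v, Q.1.IsLink e u v ↔
      (e ∉ S ∧ P.1.IsLink e u v) ∨ (e ∈ A ∧ s(u, v) = s(x, w)) ∨ (e ∈ B ∧ s(u, v) = s(w, y))) ∧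
    (∀ e ∈ E(P.1) \ S, Q.2 e = P.2 e) ∧ (∀ e ∈ A, Q.2 e = 1) ∧ (∀ e ∈ B, Q.2 e = s)

/-- `(G, σ)` is irreducible if it is not a proper subdivision of any signed graph, that is, if it
does not arise from a signed graph by one or more successive subdivision steps.  (The original
graph of a subdivision has fewer vertices and edges, so it may be taken on the same types.) -/
def IsIrreducible (G : Graph α β) (σ : β → ℤˣ) : Prop :=
  ¬ ∃ P : Graph α β × (β → ℤˣ), Relation.TransGen SubdivStep P (G, σ)

/-- `(G, σ) ∈ S*(k)`: a finite critically `k`-frustrated signed graph that is prime, i.e.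
irreducible and without two edge-disjoint negative cycles. -/
def IsPrimeCritical (k : ℕ) (G : Graph α β) (σ : β → ℤˣ) : Prop :=
  V(G).Finite ∧ E(G).Finite ∧ G.IsCriticallyFrustrated k σ ∧ G.IsIrreducible σ ∧
    ¬ ∃ C₁ C₂ : Graph α β, G.IsNegativeCycle σ C₁ ∧ G.IsNegativeCycle σ C₂ ∧
      Disjoint E(C₁) E(C₂)

/-- An isomorphism between the signed graphs `(G, σ)` and `(H, π)`. -/
structure SignedIso {α' β' : Type*} (G : Graph α β) (σ : β → ℤˣ)
    (H : Graph α' β') (π : β' → ℤˣ) where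
  /-- the bijection between the vertices -/
  onV : V(G) ≃ V(H)
  /-- the bijection between the edges -/
  onE : E(G) ≃ E(H)
  isLink_iff : ∀ (e : E(G)) (x y : V(G)),
    G.IsLink (e : β) (x : α) (y : α) ↔ H.IsLink (onE e : β') (onV x : α') (onV y : α')
  sign_eq : ∀ e : E(G), π (onE e : β') = σ (e : β)

end Graph

/-! ## Plane graphs as combinatorial maps -/

/-- A combinatorial map (a graph cellularly embedded in an oriented closed surface, given by its
rotation system) on the darts `D`: every edge consists of two opposite darts `d` and `inv d`,
a dart leaves the vertex that is its tail, and `rot` turns every dart to the next dart in the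
cyclic order around its tail.  The vertices are thus the orbits of `rot` and the edges the orbits
of `inv`. -/
structure CombMap (D : Type*) where
  /-- reversal of darts -/
  inv : Equiv.Perm D
  /-- rotation of darts around their tails -/
  rot : Equiv.Perm D
  inv_inv : ∀ d, inv (inv d) = d
  inv_ne : ∀ d, inv d ≠ d

namespace CombMap

variable {D : Type*} (M : CombMap D)

/-- The successor of a dart along the boundary walk of the face on a fixed side of it: go to the
head of the dart and turn to the next dart there. -/
def facePerm : Equiv.Perm D := M.inv.trans M.rot

/-- The vertices. -/
def Vertex : Type _ := Quotient (Equiv.Perm.SameCycle.setoid M.rot)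

/-- The edges. -/
def Edge : Type _ := Quotient (Equiv.Perm.SameCycle.setoid M.inv)

/-- The faces, i.e. the boundary walks. -/
def Face : Type _ := Quotient (Equiv.Perm.SameCycle.setoid M.facePerm)

/-- The tail of a dart. -/
def tail (d : D) : M.Vertex := Quotient.mk _ d

/-- The edge to which a dart belongs. -/
def edge (d : D) : M.Edge := Quotient.mk _ d

/-- The face whose boundary walk traverses the dart. -/
def face (d : D) : M.Face := Quotient.mk _ d

/-- The underlying multigraph. -/
def toGraph : Graph M.Vertex M.Edge where
  vertexSet := Set.univ
  IsLink e u v := ∃ d, M.edge d = e ∧ M.tail d = u ∧ M.tail (M.inv d) = v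
  isLink_symm := by
    intro e _
    refine ⟨?_⟩
    rintro u v ⟨d, rfl, rfl, rfl⟩
    exact ⟨M.inv d, Quotient.sound (Equiv.Perm.sameCycle_apply_left.2 (.refl _ _)), rfl,
      by rw [M.inv_inv]⟩
  eq_or_eq_of_isLink_of_isLink := by
    rintro e x y v w ⟨d, rfl, rfl, rfl⟩ ⟨d', h, rfl, rfl⟩
    obtain ⟨i, hi⟩ : Equiv.Perm.SameCycle M.inv d' d := Quotient.exact h
    have h2 : M.inv ^ (2 : ℤ) = 1 := by
      rw [zpow_two]
      exact Equiv.ext M.inv_inv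
    rcases Int.even_or_odd' i with ⟨j, rfl | rfl⟩
    · rw [zpow_mul, h2, one_zpow, Equiv.Perm.one_apply] at hi
      exact Or.inl (by rw [hi])
    · rw [zpow_add, zpow_mul, h2, one_zpow, one_mul, zpow_one] at hi
      exact Or.inr (by rw [hi])
  left_mem_of_isLink := fun _ _ _ _ => Set.mem_univ _

/-- The map is plane: it is connected, and it lies on the sphere, i.e. Euler's formula
`#V - #E + #F = 2` holds. -/
def IsPlane : Prop :=
  M.toGraph.IsConnected ∧
    Nat.card M.Vertex + Nat.card M.Face = Nat.card M.Edge + 2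

/-- The map is cubic: every vertex is the tail of exactly three darts (i.e. has degree three,
loops being counted twice). -/
def IsCubic : Prop :=
  ∀ v : M.Vertex, {d | M.tail d = v}.ncard = 3

/-- The edges on the boundary `C_F` of the face `F`. -/
def boundary (F : M.Face) : Set M.Edge := {e | ∃ d, M.face d = F ∧ M.edge d = e}

/-- Two distinct faces are adjacent if their boundaries share an edge. -/
def FaceAdj (F₁ F₂ : M.Face) : Prop :=
  F₁ ≠ F₂ ∧ (M.boundary F₁ ∩ M.boundary F₂).Nonempty

/-- The length of the boundary walk of the face of the dart `d`. -/
def faceLength (d : D) : ℕ := Function.minimalPeriod M.facePerm d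

/-- The subgraph formed by a set of edges and their ends. -/
def edgeSubgraph (S : Set M.Edge) : Graph M.Vertex M.Edge :=
  (M.toGraph.restrict S).induce {x | ∃ e ∈ S, M.toGraph.Inc e x}

end CombMap

/-! ## Canonical embeddings -/

/-- The data from which a signed graph with `k` negative edges is built in a canonical embedding:
a 2-connected plane cubic graph `G'`, a facial circuit `C'` of it, and `2k` vertices inserted on
the edges of `C'`.

`C'` bounds the face of the dart `base`, and its edges are numbered `0, 1, …` in their order along
`C'`, starting with the edge of `base`.  The number `weight j` is the number of vertices inserted
on the `j`-th edge. -/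
structure CapDiagram (D : Type*) (k : ℕ) where
  /-- the plane graph `G'` -/
  map : CombMap D
  isPlane : map.IsPlane
  isCubic : map.IsCubic
  isTwoConnected : map.toGraph.IsTwoConnected
  /-- the first dart of the facial circuit `C'` -/
  base : D
  /-- the weights of the edges of `C'` -/
  weight : Fin (map.faceLength base) → ℕ
  sum_weight : ∑ j, weight j = 2 * k

namespace CapDiagram

variable {D : Type*} {k : ℕ} (P : CapDiagram D k)

/-- The outer face of `G'`, bounded by `C'`; it receives the cross cap. -/
def outer : P.map.Face := P.map.face P.base

/-- The `j`-th dart of `C'` (with indices modulo the length of `C'`). -/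
def dart (j : ℕ) : D := (P.map.facePerm ^ j) P.base

/-- The vertices of the signed graph: those of `G'`, and the inserted ones, `ins j r` being the
`r`-th vertex inserted on the `j`-th edge of `C'`. -/
inductive Vert (P : CapDiagram D k)
  | old (v : P.map.Vertex)
  | ins (j : Fin (P.map.faceLength P.base)) (r : Fin (P.weight j))

/-- The edges of the signed graph: the edges of `G'` that are not on `C'`, the `weight j + 1`
segments into which the `j`-th edge of `C'` is subdivided, and `k` negative edges. -/
inductive Edg (P : CapDiagram D k)
  | old (e : P.map.Edge) (he : e ∉ P.map.boundary P.outer)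
  | seg (j : Fin (P.map.faceLength P.base)) (r : Fin (P.weight j + 1))
  | neg (i : Fin k)

/-- The points on the `j`-th edge of `C'`, in their order along `C'`: number `0` is its tail,
followed by the inserted vertices, and number `weight j + 1` is its head. -/
def point (j : Fin (P.map.faceLength P.base)) (r : ℕ) : P.Vert :=
  if r = 0 then .old (P.map.tail (P.dart j))
  else if h : r - 1 < P.weight j then .ins j ⟨r - 1, h⟩
  else .old (P.map.tail (P.dart (j + 1)))

/-- The inserted vertices `z 0, …, z (2 * k - 1)` in their cyclic order along `C'`
(lexicographically by the number of the edge and the place on it). -/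
def z (i : Fin (2 * k)) : P.Vert :=
  let p := finSigmaFinEquiv.symm (Fin.cast P.sum_weight.symm i)
  .ins p.1 p.2

/-- The incidences of the signed graph; the `i`-th negative edge joins `z i` and `z (i + k)`. -/
def Link : P.Edg → P.Vert → P.Vert → Prop
  | .old e _, u, v => ∃ a b, P.map.toGraph.IsLink e a b ∧ u = .old a ∧ v = .old b
  | .seg j r, u, v => s(u, v) = s(P.point j r, P.point j (r + 1))
  | .neg i, u, v =>
      s(u, v) = s(P.z ⟨(i : ℕ), by omega⟩, P.z ⟨(i : ℕ) + k, by omega⟩)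

/-- The underlying graph of the signed graph built from the diagram. -/
def graph : Graph P.Vert P.Edg where
  vertexSet := Set.univ
  IsLink := P.Link
  isLink_symm := by
    intro e _
    refine ⟨?_⟩
    intro u v h
    cases e with
    | old e he =>
      obtain ⟨a, b, hab, rfl, rfl⟩ := h
      exact ⟨b, a, hab.symm, rfl, rfl⟩
    | seg j r => exact Sym2.eq_swap.trans h
    | neg i => exact Sym2.eq_swap.trans h
  eq_or_eq_of_isLink_of_isLink := by
    intro e x y v w h h'
    cases e with
    | old e he =>
      obtain ⟨a, b, hab, rfl, rfl⟩ := h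
      obtain ⟨c, d, hcd, rfl, rfl⟩ := h'
      rcases hab.left_eq_or_eq hcd with h | h
      · exact Or.inl (by rw [h])
      · exact Or.inr (by rw [h])
    | seg j r =>
      have h2 : s(x, y) = s(v, w) := Eq.trans h (Eq.symm h')
      rcases Sym2.eq_iff.1 h2 with h | h
      · exact Or.inl h.1
      · exact Or.inr h.1
    | neg i =>
      have h2 : s(x, y) = s(v, w) := Eq.trans h (Eq.symm h')
      rcases Sym2.eq_iff.1 h2 with h | h
      · exact Or.inl h.1
      · exact Or.inr h.1
  left_mem_of_isLink := fun _ _ _ _ => Set.mem_univ _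

/-- The signature: exactly the `k` edges between opposite inserted vertices are negative. -/
def sign : P.Edg → ℤˣ
  | .old _ _ => 1
  | .seg _ _ => 1
  | .neg _ => -1

/-- A boundary face: a face of `G'` other than the outer one whose boundary shares an edge with
`C'`. -/
def IsBoundaryFace (F : P.map.Face) : Prop :=
  F ≠ P.outer ∧ (P.map.boundary F ∩ P.map.boundary P.outer).Nonempty

/-- An internal face: a face of `G'` other than the outer one whose boundary shares no edge with
`C'`. -/
def IsInternalFace (F : P.map.Face) : Prop :=
  F ≠ P.outer ∧ ¬ (P.map.boundary F ∩ P.map.boundary P.outer).Nonempty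

/-- A bridge face: a boundary face `F` for which the subgraph `C_F ∩ C'` is disconnected. -/
def IsBridgeFace (F : P.map.Face) : Prop :=
  P.IsBoundaryFace F ∧
    ¬ (P.map.edgeSubgraph (P.map.boundary F ∩ P.map.boundary P.outer)).IsConnected

/-- The embedding is normal: there is no bridge face. -/
def IsNormal : Prop := ∀ F, ¬ P.IsBridgeFace F

end CapDiagram

/-- A canonical embedding of the signed graph `(G, σ)` with `k` negative edges: an identification
of `(G, σ)` with the signed graph built from a diagram. -/
structure CanonicalEmbedding (D : Type*) {α β : Type*} (k : ℕ) (G : Graph α β) (σ : β → ℤˣ)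
    extends CapDiagram D k where
  /-- the identification -/
  iso : Graph.SignedIso G σ toCapDiagram.graph toCapDiagram.sign

end

/-! ### Switching, frustration index and criticality. -/

namespace Graph

variable {α β : Type*}

/-! By criticality, every edge `e` of an internal face `I` is negative in some switching with
exactly `k` negative edges. At least two of these are segments of `C'` or edges in the cross cap
(`two_le_ncard_outerNeg`), so since `k ≤ 5` at most three edges off `C'` are cut, `e` among them.
Call this set `S`. In the dual of `G'`, `S` is even at every face without an edge on `C'`.

A set `Z` of edges off `C'` that is even on every face is a cut of the sphere
(`IsPlane.exists_eq_cut`) with all of `C'` on one side. Switching at it replaces `S` by its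
symmetric difference with `Z` and changes nothing else, so minimality of `k` forbids any `Z` with
more edges in `S` than outside. Thus no dual closed walk of length at most three, its edges counted
mod 2, has most of its edges in `S`.

Parity gives `S` a second edge at `I`. If neither of the two led to a boundary face, parity would
continue `S` beyond both, and three edges only suffice for a dual triangle, which is excluded
(`IsShortCut.exists_isBoundaryFace`). Now suppose that `I` is adjacent to at most one boundary face
`A`. Some consecutive edges `d`, `d'` of `I` lead to `A` and to a face `N` that is not a boundary
face. A short cut through `d'` leaves `I` elsewhere into `A`. As `G'` is cubic, the third edge at
the vertex between `d` and `d'` separates `N` from `A`; it replaces two edges of the short cut, a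
contradiction. -/

theorem IsLink.mem_cut_iff {G : Graph α β} {e : β} {x y : α} (h : G.IsLink e x y) (X : Set α) :
    e ∈ G.cut X ↔ ¬ (x ∈ X ↔ y ∈ X) := by
  constructor
  · rintro ⟨u, v, huv, hu, hv⟩
    rcases h.eq_and_eq_or_eq_and_eq huv with ⟨rfl, rfl⟩ | ⟨rfl, rfl⟩ <;> tauto
  · intro hxy
    by_cases hx : x ∈ X
    · exact ⟨x, y, h, hx, by tauto⟩
    · exact ⟨y, x, h.symm, by tauto, hx⟩

theorem mem_cut_symmDiff (G : Graph α β) (X Y : Set α) {e : β} (he : e ∈ E(G)) :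
    e ∈ G.cut (symmDiff X Y) ↔ ¬ (e ∈ G.cut X ↔ e ∈ G.cut Y) := by
  obtain ⟨x, y, h⟩ := G.exists_isLink_of_mem_edgeSet he
  rw [h.mem_cut_iff, h.mem_cut_iff, h.mem_cut_iff, Set.mem_symmDiff, Set.mem_symmDiff]
  tauto

/-- The negative edges after switching at `∂(X)`. -/
def switchNeg (G : Graph α β) (σ : β → ℤˣ) (X : Set α) : Set β :=
  {e | e ∈ E(G) ∧ (e ∈ G.cut X ↔ σ e = 1)}

/-- Signatures are only constrained on edges of `G`, so minimizing over them is the same as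
minimizing over the vertex sets `X`, the form used from here on. -/
theorem switchingEquiv_iff_negEdges (G : Graph α β) (σ : β → ℤˣ) (n : ℕ) :
    (∃ π, G.SwitchingEquiv σ π ∧ (G.negEdges π).ncard = n) ↔
      ∃ X, (G.switchNeg σ X).ncard = n := by
  classical
  have key : ∀ π X, (∀ e ∈ E(G), (e ∈ G.cut X → π e = -σ e) ∧ (e ∉ G.cut X → π e = σ e)) →
      G.negEdges π = G.switchNeg σ X := by
    intro π X h
    ext e
    simp only [negEdges, switchNeg, Set.mem_ofPred_eq]
    refine and_congr_right fun he => ?_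
    by_cases hc : e ∈ G.cut X
    · rw [(h e he).1 hc]
      simp [hc]
    · rw [(h e he).2 hc]
      rcases Int.units_eq_one_or (σ e) with h1 | h1 <;> simp [hc, h1]
  constructor
  · rintro ⟨π, ⟨X, hX⟩, rfl⟩
    exact ⟨X, by rw [key π X hX]⟩
  · rintro ⟨X, rfl⟩
    have hX : ∀ e ∈ E(G), (e ∈ G.cut X → (if e ∈ G.cut X then -σ e else σ e) = -σ e) ∧
        (e ∉ G.cut X → (if e ∈ G.cut X then -σ e else σ e) = σ e) := by
      intro e _
      exact ⟨fun h => if_pos h, fun h => if_neg h⟩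
    exact ⟨_, ⟨X, hX⟩, by rw [key _ X hX]⟩

theorem frustrationIndex_le (G : Graph α β) (σ : β → ℤˣ) (X : Set α) :
    G.frustrationIndex σ ≤ (G.switchNeg σ X).ncard :=
  Nat.sInf_le ((switchingEquiv_iff_negEdges G σ _).2 ⟨X, rfl⟩)

theorem exists_switchNeg_eq (G : Graph α β) (σ : β → ℤˣ) :
    ∃ X, (G.switchNeg σ X).ncard = G.frustrationIndex σ := by
  refine (switchingEquiv_iff_negEdges G σ _).1 (Nat.sInf_mem (s := {n : ℕ | ∃ π : β → ℤˣ,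
    G.SwitchingEquiv σ π ∧ (G.negEdges π).ncard = n}) ?_)
  exact ⟨_, (switchingEquiv_iff_negEdges G σ _).2 ⟨∅, rfl⟩⟩

theorem switchNeg_deleteEdges (G : Graph α β) (σ : β → ℤˣ) (e : β) (X : Set α) :
    (G.deleteEdges {e}).switchNeg σ X = G.switchNeg σ X \ {e} := by
  ext f
  simp only [switchNeg, cut, edgeSet_deleteEdges, deleteEdges_isLink, Set.mem_ofPred_eq,
    Set.mem_sdiff, Set.mem_singleton_iff]
  by_cases h : f = e <;> simp [h]

/-- In a critically `k`-frustrated signed graph, every edge is among the `k` negative edges of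
some switching equivalent signature. -/
theorem IsCriticallyFrustrated.exists_switchNeg {G : Graph α β} {σ : β → ℤˣ} {k : ℕ}
    (h : G.IsCriticallyFrustrated k σ) (hfin : E(G).Finite) {e : β} (he : e ∈ E(G)) :
    ∃ X, e ∈ G.switchNeg σ X ∧ (G.switchNeg σ X).ncard = k := by
  obtain ⟨X, hX⟩ := exists_switchNeg_eq (G.deleteEdges {e}) σ
  have h1 := h.2 e he
  have h2 := G.frustrationIndex_le σ X
  have hf : (G.switchNeg σ X).Finite := hfin.subset fun f hf => hf.1
  rw [switchNeg_deleteEdges] at hX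
  rw [h.1] at h2
  -- If `e` were not negative, deleting it would leave this count unchanged: at least `k`, but also
  -- `k - 1`.
  by_cases hm : e ∈ G.switchNeg σ X
  · have := Set.ncard_sdiff_singleton_add_one hm hf
    exact ⟨X, hm, by omega⟩
  · rw [Set.sdiff_singleton_eq_self hm] at hX
    omega

/-! ### Transport along an isomorphism of signed graphs. -/

namespace SignedIso

variable {α' β' : Type*} {G : Graph α β} {σ : β → ℤˣ} {H : Graph α' β'} {π : β' → ℤˣ}

/-- The set of vertices corresponding to `X'` under an isomorphism. -/
def pullback (i : SignedIso G σ H π) (X' : Set α') : Set α :=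
  {x | ∃ h : x ∈ V(G), (i.onV ⟨x, h⟩ : α') ∈ X'}

/-- The set of vertices corresponding to `X` under an isomorphism. -/
def pushforward (i : SignedIso G σ H π) (X : Set α) : Set α' :=
  {y | ∃ h : y ∈ V(H), (i.onV.symm ⟨y, h⟩ : α) ∈ X}

theorem pullback_pushforward (i : SignedIso G σ H π) (X : Set α) :
    i.pullback (i.pushforward X) = X ∩ V(G) := by
  ext x
  simp only [pullback, pushforward, Set.mem_ofPred_eq, Set.mem_inter_iff]
  constructor
  · rintro ⟨h, h', hx⟩
    exact ⟨by simpa using hx, h⟩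
  · rintro ⟨hx, h⟩
    exact ⟨h, (i.onV ⟨x, h⟩).2, by simpa using hx⟩

theorem mem_switchNeg_iff (i : SignedIso G σ H π) (X' : Set α') (e : E(G)) :
    (i.onE e : β') ∈ H.switchNeg π X' ↔ (e : β) ∈ G.switchNeg σ (i.pullback X') := by
  obtain ⟨x, y, h⟩ := G.exists_isLink_of_mem_edgeSet e.2
  have hx := h.left_mem
  have hy := h.right_mem
  have h' := (i.isLink_iff e ⟨x, hx⟩ ⟨y, hy⟩).1 h
  simp only [switchNeg, Set.mem_ofPred_eq, e.2, (i.onE e).2, true_and, h.mem_cut_iff,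
    h'.mem_cut_iff, i.sign_eq, pullback, hx, hy, exists_true_left]

theorem ncard_switchNeg (i : SignedIso G σ H π) (X' : Set α') :
    (H.switchNeg π X').ncard = (G.switchNeg σ (i.pullback X')).ncard := by
  symm
  refine Set.ncard_congr (fun e he => (i.onE ⟨e, he.1⟩ : β')) ?_ ?_ ?_
  · intro e he
    exact (i.mem_switchNeg_iff X' ⟨e, he.1⟩).2 he
  · intro a b ha hb hab
    simpa using i.onE.injective (Subtype.ext hab)
  · intro f hf
    refine ⟨i.onE.symm ⟨f, hf.1⟩, ?_, by simp⟩
    rw [← i.mem_switchNeg_iff]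
    simpa using hf

end SignedIso

/-- A vertex set may contain points outside `V(G)`, which are lost when it is pushed forward and
pulled back; cuts do not see them. -/
theorem cut_inter_vertexSet (G : Graph α β) (X : Set α) : G.cut (X ∩ V(G)) = G.cut X := by
  ext e
  constructor
  · rintro ⟨x, y, h, hx, hy⟩
    exact ⟨x, y, h, hx.1, fun hy' => hy ⟨hy', h.right_mem⟩⟩
  · rintro ⟨x, y, h, hx, hy⟩
    exact ⟨x, y, h, ⟨hx, h.left_mem⟩, fun hy' => hy hy'.1⟩

theorem SignedIso.le_ncard_switchNeg {α' β' : Type*} {G : Graph α β} {σ : β → ℤˣ}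
    {H : Graph α' β'} {π : β' → ℤˣ} (i : SignedIso G σ H π) {k : ℕ}
    (h : G.IsCriticallyFrustrated k σ) (X : Set α') : k ≤ (H.switchNeg π X).ncard := by
  rw [i.ncard_switchNeg, ← h.1]
  exact G.frustrationIndex_le σ _

theorem SignedIso.exists_switchNeg {α' β' : Type*} {G : Graph α β} {σ : β → ℤˣ}
    {H : Graph α' β'} {π : β' → ℤˣ} (i : SignedIso G σ H π) {k : ℕ}
    (h : G.IsCriticallyFrustrated k σ) (hfin : E(G).Finite) {e : β'} (he : e ∈ E(H)) :
    ∃ X, e ∈ H.switchNeg π X ∧ (H.switchNeg π X).ncard = k := by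
  obtain ⟨X, hX, hk⟩ := h.exists_switchNeg hfin (i.onE.symm ⟨e, he⟩).2
  have hs : G.switchNeg σ (i.pullback (i.pushforward X)) = G.switchNeg σ X := by
    rw [i.pullback_pushforward, switchNeg, cut_inter_vertexSet, switchNeg]
  refine ⟨i.pushforward X, ?_, ?_⟩
  · have := (i.mem_switchNeg_iff (i.pushforward X) (i.onE.symm ⟨e, he⟩)).2 (by rwa [hs])
    simpa using this
  · rw [i.ncard_switchNeg, hs, hk]

end Graph

/-! ### Cuts and dual cycles mod 2 on the sphere. -/

namespace CombMap

variable {D : Type*} (M : CombMap D)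

instance [Finite D] : Finite M.Vertex := inferInstanceAs (Finite (Quotient _))
instance [Finite D] : Finite M.Edge := inferInstanceAs (Finite (Quotient _))
instance [Finite D] : Finite M.Face := inferInstanceAs (Finite (Quotient _))

theorem edge_inv (d : D) : M.edge (M.inv d) = M.edge d :=
  Quotient.sound (Equiv.Perm.sameCycle_apply_left.2 (.refl _ _))

theorem face_facePerm (d : D) : M.face (M.facePerm d) = M.face d :=
  Quotient.sound (Equiv.Perm.sameCycle_apply_left.2 (.refl _ _))

theorem tail_rot (d : D) : M.tail (M.rot d) = M.tail d :=
  Quotient.sound (Equiv.Perm.sameCycle_apply_left.2 (.refl _ _))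

theorem facePerm_apply (d : D) : M.facePerm d = M.rot (M.inv d) := rfl

theorem tail_facePerm (d : D) : M.tail (M.facePerm d) = M.tail (M.inv d) :=
  M.tail_rot _

theorem edge_eq_iff {d d' : D} : M.edge d = M.edge d' ↔ d = d' ∨ d = M.inv d' := by
  constructor
  · intro h
    obtain ⟨i, hi⟩ : Equiv.Perm.SameCycle M.inv d' d := (Quotient.exact h).symm
    have h2 : M.inv ^ (2 : ℤ) = 1 := by
      rw [zpow_two]
      exact Equiv.ext M.inv_inv
    rcases Int.even_or_odd' i with ⟨j, rfl | rfl⟩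
    · rw [zpow_mul, h2, one_zpow, Equiv.Perm.one_apply] at hi
      exact Or.inl hi.symm
    · rw [zpow_add, zpow_mul, h2, one_zpow, one_mul, zpow_one] at hi
      exact Or.inr hi.symm
  · rintro (rfl | rfl)
    · rfl
    · exact M.edge_inv _

theorem exists_edge_eq (e : M.Edge) : ∃ d, M.edge d = e := Quotient.exists_rep e

theorem exists_face_eq (F : M.Face) : ∃ d, M.face d = F := Quotient.exists_rep F

theorem exists_tail_eq (v : M.Vertex) : ∃ d, M.tail d = v := Quotient.exists_rep v

theorem isLink_edge (d : D) : M.toGraph.IsLink (M.edge d) (M.tail d) (M.tail (M.inv d)) :=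
  ⟨d, rfl, rfl, rfl⟩

theorem edge_mem_boundary_iff (d : D) (F : M.Face) :
    M.edge d ∈ M.boundary F ↔ M.face d = F ∨ M.face (M.inv d) = F := by
  constructor
  · rintro ⟨d', rfl, h⟩
    rcases M.edge_eq_iff.1 h with rfl | rfl
    · exact Or.inl rfl
    · exact Or.inr rfl
  · rintro (h | h)
    · exact ⟨d, h, rfl⟩
    · exact ⟨_, h, M.edge_inv d⟩

theorem _root_.Equiv.Perm.SameCycle.mem_of_forall {D : Type*} {f : Equiv.Perm D} {S : D → Prop}
    (hS : ∀ d, S (f d) ↔ S d) {a b : D} (h : f.SameCycle a b) (ha : S a) : S b := by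
  obtain ⟨i, rfl⟩ := h
  induction i with
  | zero => simpa using ha
  | succ n ih => rwa [add_comm, zpow_add, zpow_one, Equiv.Perm.mul_apply, hS]
  | pred n ih =>
    rw [← hS, ← Equiv.Perm.mul_apply]
    convert ih using 2
    rw [← zpow_one_add]
    congr 1
    ring_nf

/-- In a connected map, any set of darts that is closed under the face permutation and the
reversal, in both directions, is empty or contains all darts. -/
theorem forall_dart_of_isConnected (hM : M.toGraph.IsConnected) {S : D → Prop}
    (hf : ∀ d, S (M.facePerm d) ↔ S d) (hi : ∀ d, S (M.inv d) ↔ S d) {a : D} (ha : S a) (b : D) :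
    S b := by
  have hr : ∀ d, S (M.rot d) ↔ S d := by
    intro d
    rw [← hi d, ← hf (M.inv d), facePerm_apply, M.inv_inv]
  have hv : ∀ d d', M.tail d = M.tail d' → S d → S d' := fun d d' h hd =>
    Equiv.Perm.SameCycle.mem_of_forall hr (Quotient.exact h) hd
  have key : ∀ v, Relation.ReflTransGen M.toGraph.Adj (M.tail a) v →
      ∀ d, M.tail d = v → S d := by
    intro v h
    induction h with
    | refl => exact fun d hd => hv a d hd.symm ha
    | tail _ huv ih =>
      obtain ⟨e, d', -, hu, hw⟩ := huv
      intro d hd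
      exact hv (M.inv d') d (hw.trans hd.symm) ((hi d').2 (ih d' hu))
  exact key _ (hM.2 _ (Set.mem_univ _) _ (Set.mem_univ _)) b rfl

open Classical in
/-- The boundary operator of the dual map over the field with two elements. -/
noncomputable def faceBd [Fintype D] : (M.Edge → ZMod 2) →ₗ[ZMod 2] (M.Face → ZMod 2) where
  toFun z F := ∑ d with M.face d = F, z (M.edge d)
  map_add' z z' := by
    ext F
    simp [Finset.sum_add_distrib]
  map_smul' r z := by
    ext F
    simp [Finset.mul_sum]

open Classical in
theorem faceBd_apply [Fintype D] (z : M.Edge → ZMod 2) (F : M.Face) :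
    M.faceBd z F = ∑ d with M.face d = F, z (M.edge d) := rfl

/-- The coboundary operator of the map over the field with two elements. -/
noncomputable def cobd : (M.Vertex → ZMod 2) →ₗ[ZMod 2] (M.Edge → ZMod 2) where
  toFun y e := y (M.tail e.out) + y (M.tail (M.inv e.out))
  map_add' y y' := by
    ext e
    simp only [Pi.add_apply]
    ring
  map_smul' r y := by
    ext e
    simp [mul_add]

theorem cobd_apply_edge (y : M.Vertex → ZMod 2) (d : D) :
    M.cobd y (M.edge d) = y (M.tail d) + y (M.tail (M.inv d)) := by
  change y (M.tail (M.edge d).out) + y (M.tail (M.inv (M.edge d).out)) = _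
  have h : M.edge (M.edge d).out = M.edge d := Quotient.out_eq _
  rcases M.edge_eq_iff.1 h with h | h
  · rw [h]
  · rw [h, M.inv_inv, add_comm]

/-- Around a face the head of each dart is the tail of the next, so every tail value occurs twice in
the sum. -/
theorem faceBd_cobd [Fintype D] (y : M.Vertex → ZMod 2) : M.faceBd (M.cobd y) = 0 := by
  classical
  ext F
  simp only [faceBd_apply, cobd_apply_edge, Finset.sum_add_distrib, Pi.zero_apply]
  have : ∑ d with M.face d = F, y (M.tail (M.inv d)) = ∑ d with M.face d = F, y (M.tail d) := by
    refine Finset.sum_equiv M.facePerm ?_ ?_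
    · intro d
      simp [face_facePerm]
    · intro d _
      rw [tail_facePerm]
  rw [this]
  exact CharTwo.add_self_eq_zero _

-- Darts are counted, not edges: an edge with the same face on both sides contributes zero.
open Classical in
theorem faceBd_single [Fintype D] (d : D) :
    M.faceBd (Pi.single (M.edge d) 1) =
      Pi.single (M.face d) 1 + Pi.single (M.face (M.inv d)) 1 := by
  ext F
  rw [faceBd_apply, Finset.sum_filter]
  have h : ∀ a : D, (if M.face a = F then (Pi.single (M.edge d) 1 : M.Edge → ZMod 2) (M.edge a)
      else 0) = (if a = d then (if M.face d = F then 1 else 0) else 0) +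
        (if a = M.inv d then (if M.face (M.inv d) = F then 1 else 0) else 0) := by
    intro a
    by_cases h1 : a = d
    · subst h1
      simp [(M.inv_ne a).symm]
    · by_cases h2 : a = M.inv d
      · subst h2
        simp [M.inv_ne, edge_inv]
      · have : M.edge a ≠ M.edge d := fun h => (M.edge_eq_iff.1 h).elim h1 h2
        simp [h1, h2, this]
  simp only [h, Finset.sum_add_distrib, Finset.sum_ite_eq', Finset.mem_univ, if_true]
  simp [Pi.single_apply, eq_comm]

/-- On the sphere, a closed chain of the dual is the cut of a set of vertices. -/
theorem IsPlane.exists_cobd_eq [Fintype D] (hM : M.IsPlane) {z : M.Edge → ZMod 2} (hz : M.faceBd z = 0) :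
    ∃ y, M.cobd y = z := by
  classical
  have := Fintype.ofFinite M.Vertex
  have := Fintype.ofFinite M.Edge
  have := Fintype.ofFinite M.Face
  obtain ⟨v₀, -⟩ := hM.1.1
  obtain ⟨d₀, hd₀⟩ := M.exists_tail_eq v₀
  have hV : Module.finrank (ZMod 2) (LinearMap.ker M.cobd) ≤ 1 := by
    have hle : LinearMap.ker M.cobd ≤ Submodule.span (ZMod 2) {fun _ => 1} := by
      intro y hy
      rw [Submodule.mem_span_singleton]
      refine ⟨y v₀, ?_⟩
      have hS : ∀ d, y (M.tail d) = y v₀ := by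
        have h1 : ∀ d, y (M.tail (M.inv d)) = y (M.tail d) := by
          intro d
          have := congrFun (LinearMap.mem_ker.1 hy) (M.edge d)
          rw [cobd_apply_edge] at this
          exact (CharTwo.add_eq_zero.1 this).symm
        refine M.forall_dart_of_isConnected hM.1 (a := d₀) ?_ ?_ (by rw [hd₀])
        · intro d
          rw [tail_facePerm, h1]
        · intro d
          rw [h1]
      ext v
      obtain ⟨d, rfl⟩ := M.exists_tail_eq v
      simp [hS]
    exact (Submodule.finrank_mono hle).trans ((finrank_span_le_card _).trans (by simp))
  have hF : Fintype.card M.Face ≤ Module.finrank (ZMod 2) (LinearMap.range M.faceBd) + 1 := by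
    set W := LinearMap.range M.faceBd
    set L := Submodule.span (ZMod 2) {(Pi.single (M.face d₀) 1 : M.Face → ZMod 2)}
    -- The faces on the two sides of an edge are congruent modulo the range of `faceBd`, so by
    -- connectedness one face spans the quotient.
    have hd : ∀ d, (Pi.single (M.face d) 1 : M.Face → ZMod 2) ∈ W ⊔ L := by
      refine M.forall_dart_of_isConnected hM.1 (a := d₀) ?_ ?_ ?_
      · intro d
        rw [face_facePerm]
      · intro d
        have h1 : (Pi.single (M.face d) 1 + Pi.single (M.face (M.inv d)) 1 : M.Face → ZMod 2)
            ∈ W ⊔ L := by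
          rw [← faceBd_single]
          exact Submodule.mem_sup_left ⟨_, rfl⟩
        constructor
        · intro h
          simpa using Submodule.sub_mem _ h1 h
        · intro h
          simpa using Submodule.sub_mem _ h1 h
      · exact Submodule.mem_sup_right (Submodule.mem_span_singleton_self _)
    have htop : W ⊔ L = ⊤ := by
      rw [eq_top_iff, ← (Pi.basisFun (ZMod 2) M.Face).span_eq, Submodule.span_le]
      rintro _ ⟨F, rfl⟩
      obtain ⟨d, rfl⟩ := M.exists_face_eq F
      simpa using hd d
    have h1 := Submodule.finrank_add_le_finrank_add_finrank W L
    have h2 : Module.finrank (ZMod 2) L ≤ 1 := (finrank_span_le_card _).trans (by simp)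
    rw [htop, finrank_top, Module.finrank_fintype_fun_eq_card] at h1
    omega
  have r1 := LinearMap.finrank_range_add_finrank_ker M.cobd
  have r2 := LinearMap.finrank_range_add_finrank_ker M.faceBd
  rw [Module.finrank_fintype_fun_eq_card] at r1 r2
  have hE := hM.2
  simp only [Nat.card_eq_fintype_card] at hE
  have hle : LinearMap.range M.cobd ≤ LinearMap.ker M.faceBd := by
    rintro _ ⟨y, rfl⟩
    exact M.faceBd_cobd y
  -- By Euler's formula the kernel of `faceBd` has dimension at most `E - (F - 1) = V - 1`, which is
  -- at most the rank of `cobd`.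
  have heq := Submodule.eq_of_le_of_finrank_le hle (by omega)
  exact (heq.symm ▸ LinearMap.mem_ker.2 hz : z ∈ LinearMap.range M.cobd)

open Classical in
/-- The indicator function of a set of edges, as a chain over the field with two elements. -/
noncomputable def chain (Z : Set M.Edge) : M.Edge → ZMod 2 := fun e => if e ∈ Z then 1 else 0

theorem chain_symmDiff (Z Z' : Set M.Edge) :
    M.chain (symmDiff Z Z') = M.chain Z + M.chain Z' := by
  ext e
  by_cases h : e ∈ Z <;> by_cases h' : e ∈ Z' <;> simp [chain, Set.mem_symmDiff, h, h']
  rfl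

open Classical in
theorem chain_singleton (e : M.Edge) : M.chain {e} = Pi.single e 1 := by
  ext f
  simp [chain, Pi.single_apply]

open Classical in
theorem faceBd_chain_singleton [Fintype D] (d : D) :
    M.faceBd (M.chain {M.edge d}) =
      Pi.single (M.face d) 1 + Pi.single (M.face (M.inv d)) 1 := by
  rw [chain_singleton, faceBd_single]

theorem IsPlane.exists_eq_cut [Fintype D] (hM : M.IsPlane) {Z : Set M.Edge} (hZ : M.faceBd (M.chain Z) = 0) :
    ∃ Y, M.toGraph.cut Y = Z := by
  obtain ⟨y, hy⟩ := hM.exists_cobd_eq M hZ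
  refine ⟨{v | y v = 1}, ?_⟩
  ext e
  obtain ⟨d, rfl⟩ := M.exists_edge_eq e
  have h := congrFun hy (M.edge d)
  rw [cobd_apply_edge, chain] at h
  rw [(M.isLink_edge d).mem_cut_iff]
  simp only [Set.mem_ofPred_eq]
  generalize y (M.tail d) = a at h ⊢
  generalize y (M.tail (M.inv d)) = b at h ⊢
  split_ifs at h with h1 <;> simp only [h1] <;> revert a b <;> decide

/-- If a face has a dart crossing a cut, then it has another one. -/
theorem exists_ne_mem_cut [Fintype D] (Y : Set M.Vertex) {d : D} (hd : M.edge d ∈ M.toGraph.cut Y) :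
    ∃ d', d' ≠ d ∧ M.face d' = M.face d ∧ M.edge d' ∈ M.toGraph.cut Y := by
  classical
  by_contra! h
  -- The coboundary of the indicator of `Y` is the indicator of the cut and sums to zero around the
  -- face; a single crossing dart would give one.
  have h0 := congrFun (M.faceBd_cobd fun v => if v ∈ Y then 1 else 0) (M.face d)
  have hc : ∀ a, M.cobd (fun v => if v ∈ Y then 1 else 0) (M.edge a) =
      if M.edge a ∈ M.toGraph.cut Y then 1 else 0 := by
    intro a
    rw [cobd_apply_edge, (M.isLink_edge a).mem_cut_iff]
    by_cases h1 : M.tail a ∈ Y <;> by_cases h2 : M.tail (M.inv a) ∈ Y <;> simp [h1, h2]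
    rfl
  rw [faceBd_apply, Finset.sum_eq_single d] at h0
  · rw [hc, if_pos hd] at h0
    exact one_ne_zero h0
  · intro a ha had
    rw [hc, if_neg (h a had (by simpa using ha))]
  · intro hm
    simp at hm

end CombMap

/-! ### Switching in the signed graph of a diagram. -/

namespace CapDiagram

variable {D : Type*} {k : ℕ} (P : CapDiagram D k)

/-- The vertex of the plane graph to which a vertex of the signed graph is moved when every
inserted vertex is pushed back to the tail of its edge. -/
def proj : P.Vert → P.map.Vertex
  | .old v => v
  | .ins j _ => P.map.tail (P.dart j)

theorem face_dart (j : ℕ) : P.map.face (P.dart j) = P.outer := by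
  induction j with
  | zero => rfl
  | succ j ih =>
    rw [dart, pow_succ', Equiv.Perm.mul_apply, CombMap.face_facePerm]
    exact ih

theorem tail_dart_succ (j : ℕ) :
    P.map.tail (P.dart (j + 1)) = P.map.tail (P.map.inv (P.dart j)) := by
  rw [dart, pow_succ', Equiv.Perm.mul_apply, CombMap.tail_facePerm]
  rfl

theorem isLink_dart (j : ℕ) :
    P.map.toGraph.IsLink (P.map.edge (P.dart j)) (P.map.tail (P.dart j))
      (P.map.tail (P.dart (j + 1))) := by
  rw [tail_dart_succ]
  exact P.map.isLink_edge _

theorem edge_dart_mem_boundary (j : ℕ) :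
    P.map.edge (P.dart j) ∈ P.map.boundary P.outer :=
  ⟨_, P.face_dart j, rfl⟩

theorem exists_dart_eq [Finite D] {d : D} (hd : P.map.face d = P.outer) :
    ∃ j : Fin (P.map.faceLength P.base), P.dart j = d := by
  obtain ⟨i, hi⟩ := Equiv.Perm.SameCycle.exists_nat_pow_eq (Quotient.exact hd.symm :
    P.map.facePerm.SameCycle P.base d)
  have hpos : 0 < P.map.faceLength P.base :=
    Function.minimalPeriod_pos_of_mem_periodicPts
      (Function.Injective.mem_periodicPts P.map.facePerm.injective P.base)
  refine ⟨⟨i % P.map.faceLength P.base, Nat.mod_lt _ hpos⟩, ?_⟩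
  rw [dart, ← hi, ← Equiv.Perm.iterate_eq_pow, ← Equiv.Perm.iterate_eq_pow]
  exact Function.iterate_mod_minimalPeriod_eq

theorem point_zero (j : Fin (P.map.faceLength P.base)) :
    P.point j 0 = .old (P.map.tail (P.dart j)) := if_pos rfl

theorem point_last (j : Fin (P.map.faceLength P.base)) :
    P.point j (P.weight j + 1) = .old (P.map.tail (P.dart (j + 1))) := by
  simp [point]

theorem point_ins (j : Fin (P.map.faceLength P.base)) (r : Fin (P.weight j)) :
    P.point j (r + 1) = .ins j r := by
  simp [point]

theorem proj_point (j : Fin (P.map.faceLength P.base)) (r : ℕ) :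
    P.proj (P.point j r) = P.map.tail (P.dart j) ∨
      P.proj (P.point j r) = P.map.tail (P.dart (j + 1)) := by
  unfold point
  split_ifs <;> simp [proj]

theorem isLink_seg (j : Fin (P.map.faceLength P.base)) (r : Fin (P.weight j + 1)) :
    P.graph.IsLink (.seg j r) (P.point j r) (P.point j (r + 1)) :=
  (rfl : s(P.point j r, P.point j (r + 1)) = s(P.point j r, P.point j (r + 1)))

theorem isLink_neg (i : Fin k) :
    P.graph.IsLink (.neg i) (P.z ⟨(i : ℕ), by omega⟩) (P.z ⟨(i : ℕ) + k, by omega⟩) :=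
  (rfl : s(P.z ⟨(i : ℕ), by omega⟩, P.z ⟨(i : ℕ) + k, by omega⟩) =
    s(P.z ⟨(i : ℕ), by omega⟩, P.z ⟨(i : ℕ) + k, by omega⟩))

theorem isLink_old (d : D) (he : P.map.edge d ∉ P.map.boundary P.outer) :
    P.graph.IsLink (.old (P.map.edge d) he) (.old (P.map.tail d))
      (.old (P.map.tail (P.map.inv d))) :=
  ⟨_, _, P.map.isLink_edge d, rfl, rfl⟩

theorem edge_mem_edgeSet (e : P.Edg) : e ∈ P.graph.edgeSet := by
  cases e with
  | old e he =>
    obtain ⟨d, rfl⟩ := P.map.exists_edge_eq e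
    exact (P.isLink_old d he).edge_mem
  | seg j r => exact (P.isLink_seg j r).edge_mem
  | neg i => exact (P.isLink_neg i).edge_mem

theorem z_eq_ins (i : Fin (2 * k)) : ∃ j r, P.z i = .ins j r := ⟨_, _, rfl⟩

/-- The edges of the plane graph off `C'` that are cut by a set of vertices of the signed graph. -/
def oldCut (X : Set P.Vert) : Set P.map.Edge :=
  {e | ∃ he : e ∉ P.map.boundary P.outer, Edg.old e he ∈ P.graph.cut X}

/-- The segments of `C'` and the edges drawn in the cross cap that are negative after switching. -/
def outerNeg (X : Set P.Vert) : Set P.Edg :=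
  {f ∈ P.graph.switchNeg P.sign X | ∀ e he, f ≠ .old e he}

theorem mem_oldCut_iff (X : Set P.Vert) {e : P.map.Edge}
    (he : e ∉ P.map.boundary P.outer) :
    e ∈ P.oldCut X ↔ e ∈ P.map.toGraph.cut {v | Vert.old v ∈ X} := by
  obtain ⟨d, rfl⟩ := P.map.exists_edge_eq e
  rw [(P.map.isLink_edge d).mem_cut_iff]
  simp only [oldCut, Set.mem_ofPred_eq, he, not_false_eq_true, exists_true_left,
    (P.isLink_old d he).mem_cut_iff]

instance [Finite D] : Finite P.Edg := by
  let f : P.Edg → P.map.Edge ⊕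
      (Σ j : Fin (P.map.faceLength P.base), Fin (P.weight j + 1)) ⊕ Fin k
    | .old e _ => .inl e
    | .seg j r => .inr (.inl ⟨j, r⟩)
    | .neg i => .inr (.inr i)
  refine Finite.of_injective f ?_
  intro a b hab
  cases a <;> cases b <;> simp_all [f]

theorem ncard_switchNeg [Finite D] (X : Set P.Vert) :
    (P.graph.switchNeg P.sign X).ncard = (P.oldCut X).ncard + (P.outerNeg X).ncard := by
  have h1 : (P.oldCut X).ncard = {f ∈ P.graph.switchNeg P.sign X | ∃ e he, f = .old e he}.ncard := by
    refine Set.ncard_congr (fun e he => Edg.old e he.1) ?_ ?_ ?_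
    · rintro e ⟨he, h⟩
      exact ⟨⟨P.edge_mem_edgeSet _, iff_of_true h rfl⟩, e, he, rfl⟩
    · intro a b ha hb hab
      injection hab
    · rintro f ⟨hf, e, he, rfl⟩
      exact ⟨e, ⟨he, hf.2.2 rfl⟩, rfl⟩
  rw [h1, outerNeg, ← Set.ncard_union_eq _ (Set.toFinite _) (Set.toFinite _)]
  · congr 1
    ext f
    simp only [Set.mem_union, Set.mem_ofPred_eq, ← and_or_left]
    refine (and_iff_left ?_).symm
    by_cases h : ∃ e he, f = .old e he
    · exact Or.inl h
    · exact Or.inr (by simpa using h)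
  · rw [Set.disjoint_left]
    rintro f ⟨-, e, he, rfl⟩ ⟨-, h⟩
    exact h e he rfl

/-- If a set `Z` of edges off `C'` is even on every face, then a cut of the signed graph can be
changed by `Z`, and by nothing else. -/
theorem exists_oldCut_symmDiff [Fintype D] (X : Set P.Vert) {Z : Set P.map.Edge}
    (hZ : ∀ e ∈ Z, e ∉ P.map.boundary P.outer) (hbd : P.map.faceBd (P.map.chain Z) = 0) :
    ∃ X', P.oldCut X' = symmDiff (P.oldCut X) Z ∧ P.outerNeg X' = P.outerNeg X := by
  obtain ⟨Y, hY⟩ := P.isPlane.exists_eq_cut _ hbd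
  -- `Z` avoids `C'`, so `Y` contains all vertices of `C'` or none. Its preimage under `proj` then
  -- separates the ends of no segment and of no negative edge.
  have hdart : ∀ j, (P.map.tail (P.dart (j + 1)) ∈ Y ↔ P.map.tail (P.dart j) ∈ Y) := by
    intro j
    by_contra h
    have h1 := ((P.isLink_dart j).mem_cut_iff Y).2 (fun h' => h h'.symm)
    rw [hY] at h1
    exact hZ _ h1 (P.edge_dart_mem_boundary j)
  have hall : ∀ j, (P.map.tail (P.dart j) ∈ Y ↔ P.map.tail (P.dart 0) ∈ Y) := by
    intro j
    induction j with
    | zero => rfl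
    | succ j ih => rw [hdart, ih]
  have hpt : ∀ j r, (P.proj (P.point j r) ∈ Y ↔ P.map.tail (P.dart 0) ∈ Y) := by
    intro j r
    rcases P.proj_point j r with h | h <;> rw [h, hall]
  have hz : ∀ i, (P.proj (P.z i) ∈ Y ↔ P.map.tail (P.dart 0) ∈ Y) := fun i => hall _
  refine ⟨symmDiff X {p | P.proj p ∈ Y}, ?_, ?_⟩
  · ext e
    by_cases he : e ∈ P.map.boundary P.outer
    · refine iff_of_false (fun h => h.1 he) ?_
      rintro (h | h)
      · exact h.1.1 he
      · exact hZ e h.1 he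
    · rw [Set.mem_symmDiff, ← hY]
      simp only [oldCut, Set.mem_ofPred_eq, he, not_false_eq_true, exists_true_left]
      rw [P.graph.mem_cut_symmDiff _ _ (P.edge_mem_edgeSet _)]
      have : Edg.old e he ∈ P.graph.cut {p | P.proj p ∈ Y} ↔ e ∈ P.map.toGraph.cut Y := by
        obtain ⟨d, rfl⟩ := P.map.exists_edge_eq e
        rw [(P.map.isLink_edge d).mem_cut_iff, (P.isLink_old d he).mem_cut_iff]
        rfl
      rw [this]
      tauto
  · ext f
    refine and_congr_left fun hf => and_congr_right fun _ => ?_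
    rw [P.graph.mem_cut_symmDiff _ _ (P.edge_mem_edgeSet _)]
    have : f ∉ P.graph.cut {p | P.proj p ∈ Y} := by
      cases f with
      | old e he => exact absurd rfl (hf e he)
      | seg j r =>
        rw [(P.isLink_seg j r).mem_cut_iff, not_not, Set.mem_ofPred_eq, Set.mem_ofPred_eq,
          hpt, hpt]
      | neg i =>
        rw [(P.isLink_neg i).mem_cut_iff, not_not, Set.mem_ofPred_eq, Set.mem_ofPred_eq, hz, hz]
    tauto

theorem point_mem_iff_of_forall {X : Set P.Vert} {j : Fin (P.map.faceLength P.base)} {a b : ℕ}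
    (hab : a ≤ b) (h : ∀ r, a ≤ r → r < b → (P.point j (r + 1) ∈ X ↔ P.point j r ∈ X)) :
    P.point j b ∈ X ↔ P.point j a ∈ X := by
  induction b, hab using Nat.le_induction with
  | base => rfl
  | succ b hb ih =>
    rw [h b hb (Nat.lt_succ_self b), ih fun r h1 h2 => h r h1 (by omega)]

theorem exists_seg_mem_cut {X : Set P.Vert} {j : Fin (P.map.faceLength P.base)}
    (h : P.map.edge (P.dart j) ∈ P.map.toGraph.cut {v | Vert.old v ∈ X}) :
    ∃ r, Edg.seg j r ∈ P.graph.cut X := by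
  by_contra! hr
  rw [(P.isLink_dart j).mem_cut_iff, Set.mem_ofPred_eq, Set.mem_ofPred_eq, ← P.point_zero,
    ← P.point_last] at h
  refine h (P.point_mem_iff_of_forall (Nat.zero_le _) fun r _ h2 => ?_).symm
  have := hr ⟨r, h2⟩
  rw [(P.isLink_seg j _).mem_cut_iff, not_not] at this
  exact this.symm

/-- If the segment is the only one cut on its edge of `C'`, then the ends of that edge are
separated, and parity around the outer face yields another separated edge of `C'`. -/
theorem exists_ne_seg_mem_cut [Fintype D] {X : Set P.Vert} {j : Fin (P.map.faceLength P.base)}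
    {r : Fin (P.weight j + 1)} (h : Edg.seg j r ∈ P.graph.cut X) :
    ∃ j' r', Edg.seg (P := P) j' r' ≠ .seg j r ∧ Edg.seg j' r' ∈ P.graph.cut X := by
  by_contra! hne
  have hj : ∀ s : ℕ, s < P.weight j + 1 → s ≠ r →
      (P.point j (s + 1) ∈ X ↔ P.point j s ∈ X) := by
    intro s hs hsr
    have := hne j ⟨s, hs⟩ (by
      intro h
      injection h with _ h
      exact hsr (congrArg Fin.val h))
    rw [(P.isLink_seg j _).mem_cut_iff, not_not] at this
    exact this.symm
  have h1 := P.point_mem_iff_of_forall (Nat.zero_le (r : ℕ))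
    fun s _ hs => hj s (by omega) (by omega)
  have h2 := P.point_mem_iff_of_forall (X := X) (j := j) (a := r + 1) (b := P.weight j + 1)
    (by omega) fun s hs hs' => hj s hs' (by omega)
  rw [(P.isLink_seg j r).mem_cut_iff] at h
  have hc : P.map.edge (P.dart j) ∈ P.map.toGraph.cut {v | Vert.old v ∈ X} := by
    rw [(P.isLink_dart j).mem_cut_iff, Set.mem_ofPred_eq, Set.mem_ofPred_eq, ← P.point_zero,
      ← P.point_last]
    tauto
  obtain ⟨d, hd, hf, hdc⟩ := P.map.exists_ne_mem_cut _ hc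
  obtain ⟨j', rfl⟩ := P.exists_dart_eq (hf.trans (P.face_dart j))
  obtain ⟨r', hr'⟩ := P.exists_seg_mem_cut hdc
  refine hne j' r' ?_ hr'
  intro h
  injection h with h
  exact hd (by rw [h])

/-- Every switching equivalent signature has at least two negative edges among the segments of
`C'` and the edges drawn in the cross cap. -/
theorem two_le_ncard_outerNeg [Fintype D] (hk : 2 ≤ k) (X : Set P.Vert) :
    2 ≤ (P.outerNeg X).ncard := by
  by_cases hs : ∃ j r, Edg.seg j r ∈ P.graph.cut X
  · obtain ⟨j, r, h⟩ := hs
    obtain ⟨j', r', hne, h'⟩ := P.exists_ne_seg_mem_cut h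
    rw [← Set.ncard_pair hne]
    refine Set.ncard_le_ncard ?_ (Set.toFinite _)
    rintro f (rfl | rfl)
    · exact ⟨⟨P.edge_mem_edgeSet _, iff_of_true h' rfl⟩, fun _ _ h => by cases h⟩
    · exact ⟨⟨P.edge_mem_edgeSet _, iff_of_true h rfl⟩, fun _ _ h => by cases h⟩
  -- With no segment cut, all points of `C'` are on one side, so all `k` edges in the cross cap stay
  -- negative.
  · push Not at hs
    have hseg : ∀ j (b : ℕ), b ≤ P.weight j + 1 →
        (P.point j b ∈ X ↔ Vert.old (P.map.tail (P.dart j)) ∈ X) := by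
      intro j b hb
      rw [← P.point_zero]
      refine P.point_mem_iff_of_forall (Nat.zero_le _) fun r _ h2 => ?_
      have := hs j ⟨r, by omega⟩
      rw [(P.isLink_seg j _).mem_cut_iff, not_not] at this
      exact this.symm
    have hall : ∀ j : ℕ, j < P.map.faceLength P.base →
        (Vert.old (P.map.tail (P.dart j)) ∈ X ↔ Vert.old (P.map.tail (P.dart 0)) ∈ X) := by
      intro j
      induction j with
      | zero => exact fun _ => Iff.rfl
      | succ j ih =>
        intro hj
        rw [← ih (by omega), ← hseg ⟨j, by omega⟩ _ le_rfl, P.point_last]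
    have hz : ∀ i, (P.z i ∈ X ↔ Vert.old (P.map.tail (P.dart 0)) ∈ X) := by
      intro i
      obtain ⟨j, r, h⟩ := P.z_eq_ins i
      rw [h, ← P.point_ins, hseg j _ (by omega), hall j j.2]
    have hneg : ∀ i : Fin k, Edg.neg i ∈ P.outerNeg X := by
      intro i
      refine ⟨⟨P.edge_mem_edgeSet _, iff_of_false ?_ (by simp [sign])⟩, fun _ _ h => by cases h⟩
      rw [(P.isLink_neg i).mem_cut_iff, not_not, hz, hz]
    have hne : (Edg.neg ⟨0, by omega⟩ : P.Edg) ≠ .neg ⟨1, by omega⟩ := by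
      intro h
      injection h with h
      simp at h
    rw [← Set.ncard_pair hne]
    refine Set.ncard_le_ncard ?_ (Set.toFinite _)
    rintro f (rfl | rfl) <;> exact hneg _

end CapDiagram

/-! ### Short cuts and the exchange argument. -/

namespace CapDiagram

variable {D : Type*} {k : ℕ} (P : CapDiagram D k)

/-- A set of vertices of the plane graph whose cut has at most three edges off `C'`, where no
exchange along a set of edges off `C'` that is even on every face makes this number smaller. -/
structure IsShortCut [Fintype D] (Y : Set P.map.Vertex) (S : Set P.map.Edge) : Prop where
  mem_iff : ∀ e, e ∈ S ↔ e ∉ P.map.boundary P.outer ∧ e ∈ P.map.toGraph.cut Y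
  ncard_le : S.ncard ≤ 3
  exchange : ∀ Z : Set P.map.Edge, (∀ e ∈ Z, e ∉ P.map.boundary P.outer) →
    P.map.faceBd (P.map.chain Z) = 0 → (Z ∩ S).ncard ≤ (Z \ S).ncard

/-- At least two of the at most five negative edges belong to `outerNeg`, which leaves three. The
exchange property is the minimality of `k` after switching along `Z`, where the edges of `S` outside
`Z` cancel. -/
theorem exists_isShortCut [Fintype D] (hk : 2 ≤ k) (hk' : k ≤ 5)
    (hmin : ∀ X, k ≤ (P.graph.switchNeg P.sign X).ncard)
    (hcrit : ∀ f ∈ P.graph.edgeSet, ∃ X, f ∈ P.graph.switchNeg P.sign X ∧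
      (P.graph.switchNeg P.sign X).ncard = k)
    {e : P.map.Edge} (he : e ∉ P.map.boundary P.outer) :
    ∃ Y S, P.IsShortCut Y S ∧ e ∈ S := by
  obtain ⟨X, hX, hXk⟩ := hcrit (.old e he) (P.edge_mem_edgeSet _)
  have h2 := P.two_le_ncard_outerNeg hk X
  rw [P.ncard_switchNeg] at hXk
  refine ⟨{v | Vert.old v ∈ X}, P.oldCut X, ⟨?_, by omega, ?_⟩, he, hX.2.2 rfl⟩
  · intro f
    by_cases hf : f ∈ P.map.boundary P.outer
    · exact iff_of_false (fun h => h.1 hf) fun h => h.1 hf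
    · rw [P.mem_oldCut_iff X hf, and_iff_right hf]
  · intro Z hZ hbd
    obtain ⟨X', h, h'⟩ := P.exists_oldCut_symmDiff X hZ hbd
    have hm := hmin X'
    rw [P.ncard_switchNeg, h, h', Set.symmDiff_def,
      Set.ncard_union_eq disjoint_sdiff_sdiff (Set.toFinite _) (Set.toFinite _)] at hm
    have hS := Set.ncard_inter_add_ncard_sdiff_eq_ncard (P.oldCut X) Z (Set.toFinite _)
    rw [Set.inter_comm] at hS
    omega

namespace IsShortCut

variable {P} [Fintype D] {Y : Set P.map.Vertex} {S : Set P.map.Edge}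

/-- Exchanging along a subset of `S` would only remove negative edges. -/
theorem eq_empty_of_subset (h : P.IsShortCut Y S) {Z : Set P.map.Edge} (hZ : Z ⊆ S)
    (hbd : P.map.faceBd (P.map.chain Z) = 0) : Z = ∅ := by
  have h1 := h.exchange Z (fun e he => ((h.mem_iff e).1 (hZ he)).1) hbd
  rw [Set.inter_eq_left.2 hZ, Set.sdiff_eq_empty.2 hZ, Set.ncard_empty] at h1
  exact (Set.ncard_eq_zero (Set.toFinite _)).1 (by omega)

/-- An edge with one face on both sides is a dual loop, hence an even set by itself. -/
theorem face_inv_ne (h : P.IsShortCut Y S) {d : D} (hd : P.map.edge d ∈ S) :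
    P.map.face (P.map.inv d) ≠ P.map.face d := by
  classical
  intro hf
  refine Set.singleton_ne_empty _
    (h.eq_empty_of_subset (Z := {P.map.edge d}) (by simpa using hd) ?_)
  rw [CombMap.faceBd_chain_singleton, hf]
  exact ZModModule.add_self _

/-- A face having no edge on `C'` and a dart in a short cut has another such dart. -/
theorem exists_ne (h : P.IsShortCut Y S) {d : D} (hd : P.map.edge d ∈ S)
    (hF : ∀ d', P.map.face d' = P.map.face d → P.map.edge d' ∉ P.map.boundary P.outer) :
    ∃ d', P.map.face d' = P.map.face d ∧ P.map.edge d' ∈ S ∧ P.map.edge d' ≠ P.map.edge d := by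
  obtain ⟨d', hne, hf, hc⟩ := P.map.exists_ne_mem_cut Y ((h.mem_iff _).1 hd).2
  refine ⟨d', hf, (h.mem_iff _).2 ⟨hF d' hf, hc⟩, fun he => ?_⟩
  rcases P.map.edge_eq_iff.1 he with rfl | rfl
  · exact hne rfl
  · exact h.face_inv_ne hd hf

/-- Two darts of one face in a short cut have different faces on their other sides. -/
theorem face_inv_ne_face_inv (h : P.IsShortCut Y S) {a b : D} (ha : P.map.edge a ∈ S)
    (hb : P.map.edge b ∈ S) (hf : P.map.face a = P.map.face b)
    (hab : P.map.edge a ≠ P.map.edge b) :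
    P.map.face (P.map.inv a) ≠ P.map.face (P.map.inv b) := by
  classical
  intro hi
  have hsub : symmDiff {P.map.edge a} {P.map.edge b} ⊆ S := by
    rintro e (⟨rfl, -⟩ | ⟨rfl, -⟩) <;> assumption
  have h0 := h.eq_empty_of_subset hsub (by
    rw [CombMap.chain_symmDiff, map_add, CombMap.faceBd_chain_singleton,
      CombMap.faceBd_chain_singleton, hf, hi]
    exact ZModModule.add_self _)
  rw [← Set.bot_eq_empty, symmDiff_eq_bot] at h0
  exact hab (Set.singleton_injective h0)

/-- There are no two edges of a short cut and a third edge off `C'` that together are the edges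
crossed by a closed walk through three faces. -/
theorem not_triangle (h : P.IsShortCut Y S) {a b c : D} (ha : P.map.edge a ∈ S)
    (hb : P.map.edge b ∈ S) (hab : P.map.edge a ≠ P.map.edge b)
    (hf : P.map.face a = P.map.face b) (hc : P.map.edge c ∉ P.map.boundary P.outer)
    (hca : P.map.face c = P.map.face (P.map.inv a))
    (hcb : P.map.face (P.map.inv c) = P.map.face (P.map.inv b)) : False := by
  classical
  -- The symmetric difference allows `c` to lie on the same edge as `a` or `b`.
  set Z : Set P.map.Edge := symmDiff (symmDiff {P.map.edge a} {P.map.edge b}) {P.map.edge c}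
    with hZ
  have hmem : ∀ e, e ∈ Z ↔ ¬ ((¬ (e = P.map.edge a ↔ e = P.map.edge b)) ↔ e = P.map.edge c) := by
    intro e
    simp only [hZ, Set.mem_symmDiff, Set.mem_singleton_iff]
    tauto
  have hbd : P.map.faceBd (P.map.chain Z) = 0 := by
    rw [CombMap.chain_symmDiff, CombMap.chain_symmDiff, map_add, map_add,
      CombMap.faceBd_chain_singleton, CombMap.faceBd_chain_singleton,
      CombMap.faceBd_chain_singleton, hca, hcb, hf]
    generalize (Pi.single (P.map.face b) 1 : P.map.Face → ZMod 2) = x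
    generalize (Pi.single (P.map.face (P.map.inv a)) 1 : P.map.Face → ZMod 2) = y
    generalize (Pi.single (P.map.face (P.map.inv b)) 1 : P.map.Face → ZMod 2) = z
    rw [← ZModModule.add_self (x + y + z)]
    abel
  -- If the edge of `c` is in `S`, then `Z ⊆ S` must be empty, impossible for a sum of three edges
  -- mod 2. Otherwise `Z` has two edges in `S` and at most one outside.
  by_cases hcS : P.map.edge c ∈ S
  · have hsub : Z ⊆ S := by
      intro e he
      rw [hmem] at he
      by_cases h1 : e = P.map.edge a
      · rwa [h1]
      by_cases h2 : e = P.map.edge b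
      · rwa [h2]
      by_cases h3 : e = P.map.edge c
      · rwa [h3]
      tauto
    have h0 := h.eq_empty_of_subset hsub hbd
    have h1 : P.map.edge a ∉ Z := by rw [h0]; exact Set.notMem_empty _
    have h2 : P.map.edge b ∉ Z := by rw [h0]; exact Set.notMem_empty _
    rw [hmem] at h1 h2
    have h3 : P.map.edge a = P.map.edge c := by tauto
    have h4 : P.map.edge b = P.map.edge c := by
      have := hab.symm
      tauto
    exact hab (h3.trans h4.symm)
  · have hac : P.map.edge a ≠ P.map.edge c := fun h' => hcS (h' ▸ ha)
    have hbc : P.map.edge b ≠ P.map.edge c := fun h' => hcS (h' ▸ hb)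
    have h1 : ({P.map.edge a, P.map.edge b} : Set P.map.Edge).ncard ≤ (Z ∩ S).ncard := by
      refine Set.ncard_le_ncard ?_ (Set.toFinite _)
      rintro e (rfl | rfl)
      · exact ⟨(hmem _).2 (by tauto), ha⟩
      · have := hab.symm
        exact ⟨(hmem _).2 (by tauto), hb⟩
    have h2 : (Z \ S).ncard ≤ ({P.map.edge c} : Set P.map.Edge).ncard := by
      refine Set.ncard_le_ncard ?_ (Set.toFinite _)
      rintro e ⟨he, heS⟩
      rw [hmem] at he
      have h3 : e ≠ P.map.edge a := fun h' => heS (h' ▸ ha)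
      have h4 : e ≠ P.map.edge b := fun h' => heS (h' ▸ hb)
      rw [Set.mem_singleton_iff]
      tauto
    have h3 := h.exchange Z (fun e he => by
      rw [hmem] at he
      by_cases h1 : e = P.map.edge a
      · exact ((h.mem_iff e).1 (h1 ▸ ha)).1
      by_cases h2 : e = P.map.edge b
      · exact ((h.mem_iff e).1 (h2 ▸ hb)).1
      by_cases h3 : e = P.map.edge c
      · rwa [h3]
      tauto) hbd
    rw [Set.ncard_pair hab] at h1
    rw [Set.ncard_singleton] at h2
    omega

end IsShortCut

theorem IsInternalFace.edge_notMem {P : CapDiagram D k} {I : P.map.Face} (hI : P.IsInternalFace I)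
    {d : D} (hd : P.map.face d = I) : P.map.edge d ∉ P.map.boundary P.outer :=
  fun h => hI.2 ⟨_, ⟨d, hd, rfl⟩, h⟩

theorem isBoundaryFace_of_mem {d d' : D}
    (hd : P.map.edge d ∉ P.map.boundary P.outer) (hf : P.map.face d' = P.map.face d)
    (he : P.map.edge d' ∈ P.map.boundary P.outer) : P.IsBoundaryFace (P.map.face d) :=
  ⟨fun h => hd ⟨d, h, rfl⟩, _, ⟨d', hf, rfl⟩, he⟩

/-- A short cut that contains an edge of an internal face contains another edge of this face, and
one of the two leads to a boundary face. -/
theorem IsShortCut.exists_isBoundaryFace [Fintype D] {P : CapDiagram D k}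
    {Y : Set P.map.Vertex} {S : Set P.map.Edge} (h : P.IsShortCut Y S) {I : P.map.Face}
    (hI : P.IsInternalFace I) {d : D} (hd : P.map.face d = I) (hdS : P.map.edge d ∈ S) :
    ∃ d', P.map.face d' = I ∧ P.map.edge d' ∈ S ∧ P.map.edge d' ≠ P.map.edge d ∧
      (P.IsBoundaryFace (P.map.face (P.map.inv d)) ∨
        P.IsBoundaryFace (P.map.face (P.map.inv d'))) := by
  obtain ⟨d', hf, hS, hne⟩ := h.exists_ne hdS fun a ha => hI.edge_notMem (ha.trans hd)
  refine ⟨d', hf.trans hd, hS, hne, ?_⟩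
  by_contra! hb
  -- A face across `a` that is not a boundary face has no edge on `C'`, so parity applies there as
  -- well.
  have hother : ∀ a, P.map.edge a ∈ S → ¬ P.IsBoundaryFace (P.map.face (P.map.inv a)) →
      ∃ b, P.map.face b = P.map.face (P.map.inv a) ∧ P.map.edge b ∈ S ∧
        P.map.edge b ≠ P.map.edge a := by
    intro a ha hab
    rw [← P.map.edge_inv a] at ha
    have := h.exists_ne ha fun b hb' hbo =>
      hab (P.isBoundaryFace_of_mem ((h.mem_iff _).1 ha).1 hb' hbo)
    rwa [P.map.edge_inv] at this
  obtain ⟨a, haf, haS, hae⟩ := hother d hdS hb.1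
  obtain ⟨b, hbf, hbS, hbe⟩ := hother d' hS hb.2
  have hNN := h.face_inv_ne_face_inv hS hdS hf hne
  have hae' : P.map.edge a ≠ P.map.edge d' := by
    intro he
    rcases P.map.edge_eq_iff.1 he with rfl | rfl
    · exact h.face_inv_ne hdS (haf.symm.trans hf)
    · exact hNN haf
  have hbe' : P.map.edge b ≠ P.map.edge d := by
    intro he
    rcases P.map.edge_eq_iff.1 he with rfl | rfl
    · exact h.face_inv_ne hS (hbf.symm.trans hf.symm)
    · exact hNN hbf.symm
  -- Otherwise `S` would have four edges. The common edge then closes a dual triangle inside `S`.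
  have hab : P.map.edge a = P.map.edge b := by
    by_contra hab
    have h4 : ({P.map.edge d, P.map.edge d', P.map.edge a, P.map.edge b} :
        Set P.map.Edge).ncard ≤ S.ncard := by
      refine Set.ncard_le_ncard ?_ (Set.toFinite _)
      rintro e (rfl | rfl | rfl | rfl) <;> assumption
    rw [Set.ncard_insert_of_notMem (by simp [hne.symm, hae.symm, hbe'.symm]),
      Set.ncard_insert_of_notMem (by simp [hae'.symm, hbe.symm]), Set.ncard_pair hab] at h4
    have := h.ncard_le
    omega
  rcases P.map.edge_eq_iff.1 hab with rfl | rfl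
  · exact hNN (hbf.symm.trans haf)
  · exact h.not_triangle hdS hS hne.symm hf.symm ((h.mem_iff _).1 haS).1 haf
      (by rw [P.map.inv_inv, hbf])

end CapDiagram

/-! ### The third edge at a cubic vertex, and the conclusion. -/

theorem CombMap.IsCubic.rot_rot_rot {D : Type*} [Finite D] {M : CombMap D} (h : M.IsCubic)
    (d : D) : M.rot (M.rot (M.rot d)) = d := by
  classical
  cases nonempty_fintype D
  by_cases hd : M.rot d = d
  · rw [hd, hd, hd]
  have hcard : (M.rot.cycleOf d).support.card = 3 := by
    rw [← h (M.tail d), ← Set.ncard_coe_finset]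
    congr 1
    ext a
    rw [Finset.mem_coe, Equiv.Perm.mem_support_cycleOf_iff, Equiv.Perm.mem_support,
      and_iff_left hd]
    exact ⟨fun h => (Quotient.sound h).symm, fun h => (Quotient.exact h).symm⟩
  have := Equiv.Perm.pow_mod_card_support_cycleOf_self_apply M.rot 3 d
  rw [hcard] at this
  exact this.symm

theorem lemma2p13 {α β D : Type*} [Finite D] {k : ℕ} (hk : k = 4 ∨ k = 5)
    (G : Graph α β) (σ : β → ℤˣ) (hG : G.IsPrimeCritical k σ)
    (Γ : CanonicalEmbedding D k G σ) (hΓ : Γ.IsNormal)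
    (I : Γ.map.Face) (hI : Γ.IsInternalFace I) :
    ∃ F₁ F₂ : Γ.map.Face, F₁ ≠ F₂ ∧ Γ.IsBoundaryFace F₁ ∧ Γ.IsBoundaryFace F₂ ∧
      Γ.map.FaceAdj I F₁ ∧ Γ.map.FaceAdj I F₂ := by
  cases nonempty_fintype D
  have hshort : ∀ d, Γ.map.face d = I → ∃ Y S, Γ.IsShortCut Y S ∧ Γ.map.edge d ∈ S := fun d hd =>
    Γ.exists_isShortCut (by omega) (by omega) (fun X => Γ.iso.le_ncard_switchNeg hG.2.2.1 X)
      (fun _ hf => Γ.iso.exists_switchNeg hG.2.2.1 hG.2.1 hf) (hI.edge_notMem hd)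
  have hadj : ∀ d, Γ.map.face d = I → Γ.IsBoundaryFace (Γ.map.face (Γ.map.inv d)) →
      Γ.map.FaceAdj I (Γ.map.face (Γ.map.inv d)) := by
    intro d hd hb
    refine ⟨fun h => ?_, Γ.map.edge d, ⟨d, hd, rfl⟩, _, rfl, Γ.map.edge_inv d⟩
    rw [← h] at hb
    exact hI.2 hb.2
  by_contra! hno
  have huniq : ∀ a b, Γ.map.face a = I → Γ.map.face b = I →
      Γ.IsBoundaryFace (Γ.map.face (Γ.map.inv a)) → Γ.IsBoundaryFace (Γ.map.face (Γ.map.inv b)) →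
      Γ.map.face (Γ.map.inv a) = Γ.map.face (Γ.map.inv b) := by
    intro a b ha hb hBa hBb
    by_contra hne
    exact hno _ _ hne hBa hBb (hadj a ha hBa) (hadj b hb hBb)
  -- some dart of `I` leads to a boundary face, and some other one does not
  obtain ⟨d₀, hd₀⟩ := Γ.map.exists_face_eq I
  have hexists : ∃ a b, Γ.map.face a = I ∧ Γ.map.face b = I ∧
      Γ.IsBoundaryFace (Γ.map.face (Γ.map.inv a)) ∧
      ¬ Γ.IsBoundaryFace (Γ.map.face (Γ.map.inv b)) := by
    obtain ⟨Y, S, h, hS⟩ := hshort d₀ hd₀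
    obtain ⟨d₁, hd₁, hS₁, hne, hb⟩ := h.exists_isBoundaryFace hI hd₀ hS
    have hNN := h.face_inv_ne_face_inv hS₁ hS (hd₁.trans hd₀.symm) hne
    rcases hb with hb | hb
    · exact ⟨d₀, d₁, hd₀, hd₁, hb, fun hb' => hNN (huniq _ _ hd₁ hd₀ hb' hb)⟩
    · exact ⟨d₁, d₀, hd₁, hd₀, hb, fun hb' => hNN (huniq _ _ hd₁ hd₀ hb hb')⟩
  -- Going around `I` from a dart leading to a boundary face to one that does not, the property
  -- fails for the first time somewhere.
  have hcons : ∃ d, Γ.map.face d = I ∧ Γ.IsBoundaryFace (Γ.map.face (Γ.map.inv d)) ∧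
      ¬ Γ.IsBoundaryFace (Γ.map.face (Γ.map.inv (Γ.map.facePerm d))) := by
    obtain ⟨a, b, ha, hb, hBa, hBb⟩ := hexists
    by_contra! hall
    obtain ⟨n, rfl⟩ := Equiv.Perm.SameCycle.exists_nat_pow_eq
      (Quotient.exact (ha.trans hb.symm) : Γ.map.facePerm.SameCycle a b)
    refine hBb ?_
    have : ∀ n : ℕ, Γ.map.face ((Γ.map.facePerm ^ n) a) = I ∧
        Γ.IsBoundaryFace (Γ.map.face (Γ.map.inv ((Γ.map.facePerm ^ n) a))) := by
      intro n
      induction n with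
      | zero => exact ⟨ha, hBa⟩
      | succ n ih =>
        rw [pow_succ', Equiv.Perm.mul_apply]
        exact ⟨(Γ.map.face_facePerm _).trans ih.1, hall _ ih.1 ih.2⟩
    exact (this n).2
  obtain ⟨d, hd, hB, hB'⟩ := hcons
  have hd' : Γ.map.face (Γ.map.facePerm d) = I := (Γ.map.face_facePerm d).trans hd
  obtain ⟨Y, S, h, hS⟩ := hshort _ hd'
  obtain ⟨d₁, hd₁, hS₁, hne, hb⟩ := h.exists_isBoundaryFace hI hd' hS
  have hA := huniq _ _ hd hd₁ hB (hb.resolve_left hB')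
  -- the third edge at the common vertex of `d` and its successor gives a shortcut
  have hc : Γ.map.face (Γ.map.rot (Γ.map.facePerm d)) =
      Γ.map.face (Γ.map.inv (Γ.map.facePerm d)) := by
    rw [← Γ.map.face_facePerm (Γ.map.inv (Γ.map.facePerm d)), Γ.map.facePerm_apply (Γ.map.inv _),
      Γ.map.inv_inv]
  -- As `rot` has order three at the vertex, the face successor of the reversed third dart is `rot`
  -- applied three times to `inv d`, that is, `inv d` itself.
  have hc' : Γ.map.face (Γ.map.inv (Γ.map.rot (Γ.map.facePerm d))) =
      Γ.map.face (Γ.map.inv d₁) := by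
    rw [← hA, ← Γ.map.face_facePerm (Γ.map.inv (Γ.map.rot _)), Γ.map.facePerm_apply (Γ.map.inv _),
      Γ.map.inv_inv, Γ.map.facePerm_apply, Γ.isCubic.rot_rot_rot]
  refine h.not_triangle hS hS₁ hne.symm (hd'.trans hd₁.symm) (fun ho => ?_) hc hc'
  -- Were the third edge on `C'`, one of its two faces would be the outer one. The first is across
  -- an edge of the internal face `I`, and the second is a boundary face.
  rcases (Γ.map.edge_mem_boundary_iff _ _).1 ho with ho | ho
  · refine hI.edge_notMem hd' ((Γ.map.edge_mem_boundary_iff _ _).2 (Or.inr ?_))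
    rw [← hc, ho]
  · exact hB.1 (hA.trans (hc'.symm.trans ho))
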